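/- **Conventions.** A second-order signature $\Sigma$ is a set of operators with arities in $\mathbb N^*$; second-order terms $\Theta\triangleright\Gamma\vdash t$ (with $\Theta$ a context of metavariables $\mathsf m_i:[m_i]$ and $\Gamma$ a context of variables, up to $\alpha$-equivalence) are built from variables $x$, metavariable applications $\mathsf m[t_1,\dots,t_m]$ and operators $\omega((\vec x_1)t_1,\dots,(\vec x_k)t_k)$, where $\omega:(n_1,\dots,n_k)$ binds $n_i$ variables in its $i$-th argument; terms without operators are elementary. A presentation $\mathcal E=(\Sigma,E)$ is a signature with a set $E$ of equations $\Theta\triangleright\Gamma\vdash s\equiv t$; provable equality $\vdash_{\mathcal E}$ is generated by the axioms, reflexivity, symmetry, transitivity and extended metasubstitution: from $\mathsf m_1:[m_1],\dots,\mathsf m_k:[m_k]\triangleright\Gamma\vdash s\equiv t$ and $\Theta\triangleright\Delta,\vec x_i\vdash s_i\equiv t_i$ infer $\Theta\triangleright\Gamma,\Delta\vdash s\{\mathsf m_i:=(\vec x_i)s_i\}\equiv t\{\mathsf m_i:=(\vec x_i)t_i\}$. A syntactic translation $\tau:\mathcal E\to\mathcal E'$ assigns to each operator $\omega:(m_1,\dots,m_k)$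 of $\mathcal E$ a term $\mathsf m_1:[m_1],\dots,\mathsf m_k:[m_k]\triangleright-\vdash\tau_\omega$ of $\mathcal E'$, such that its extension to terms, given by $\tau(x)=x$, $\tau(\mathsf m[\dots,t_j,\dots])=\mathsf m[\dots,\tau(t_j),\dots]$, $\tau(\omega(\dots,(\vec x_i)t_i,\dots))=\tau_\omega\{\mathsf m_i:=(\vec x_i)\tau(t_i)\}_i$, maps axioms of $\mathcal E$ to theorems of $\mathcal E'$. The identity is $\tau^{\mathcal E}_\omega=\omega((\vec x_1)\mathsf m_1[\vec x_1],\dots,(\vec x_k)\mathsf m_k[\vec x_k])$ and the composite is $(\tau'\circ\tau)_\omega=\tau'(\tau_\omega)$. $\mathbf{SOEP}$ is the category of presentations and syntactic translations, where $\tau,\tau':\mathcal E\to\mathcal E'$ are identified if $\tau_\omega$ and $\tau'_\omega$ are provably equal in $\mathcal E'$ for every operator $\omega$. $\mathbf M$ is the category with objects $\mathbb N^*$, whose morphisms $(m_1,\dots,m_k)\to(n_1,\dots,n_l)$ are tuples $\langle \mathsf m_1:[m_1],\dots,\mathsf m_k:[m_k]\triangleright x_1,\dots,x_{n_i}\vdash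 t_i\rangle_{i\le l}$ of elementary terms, with composition by metasubstitution; products are given by concatenation, and $(0)$ is exponentiable with $(0)\Rightarrow(m_1,\dots,m_k)=(m_1+1,\dots,m_k+1)$. A second-order algebraic theory is an identity-on-objects functor $M:\mathbf M\to\mathcal M$ to a small category that preserves the finite products strictly and preserves the exponentiable object $(0)$. For a presentation $\mathcal E$, the category $\mathbf M(\mathcal E)$ is defined like $\mathbf M$, with tuples of classes $[t]_{\mathcal E}$ of terms over $\Sigma$ modulo provable equality in $\mathcal E$; with the evident functor $M_{\mathcal E}:\mathbf M\to\mathbf M(\mathcal E)$ it is a second-order algebraic theory, the classifying theory of $\mathcal E$. The internal language $\mathrm{IL}(M)$ of a theory $M:\mathbf M\to\mathcal M$ has an operator $\omega_f:(m_1,\dots,m_k,0^n)$ for each $f:(m_1,\dots,m_k)\to(n)$ in $\mathcal M$. Writing $\mathsf t_f=\omega_f((\vec x_1)\mathsf m_1[\vec x_1],\dots,(\vec x_k)\mathsf m_k[\vec x_k],x_1,\dots,x_n)$, its axioms are $s\equiv\mathsf t_{M\langle s\rangle}$ for each $\langle s\rangle:(m_1,\dots,m_k)\to(n)$ in $\mathbf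 M$, and $\mathsf t_h\equiv\mathsf t_g\{\mathsf m_i:=(\vec x_i)\mathsf t_{f_i}\}_{i\le l}$ whenever $h=g\circ\langle f_1,\dots,f_l\rangle$ in $\mathcal M$, for $h:(m_1,\dots,m_k)\to(n)$, $g:(n_1,\dots,n_l)\to(n)$, $f_i:(m_1,\dots,m_k)\to(n_i)$. **Theorem 6.5 (Second-order presentation/theory correspondence).** For every second-order equational presentation $\mathcal E$: 1. the natural translation $\omega\mapsto\mathsf t_{\langle[\tau^{\mathcal E}_\omega]_{\mathcal E}\rangle}$ is a syntactic translation $\hat\tau_{\mathcal E}:\mathcal E\to\mathrm{IL}(M_{\mathcal E})$; 2. the opposite natural translation, which maps the operator $\omega_{\langle[t]_{\mathcal E}\rangle}$, for $\mathsf m_1:[m_1],\dots,\mathsf m_k:[m_k]\triangleright x_1,\dots,x_n\vdash t$, to $\mathsf m_1:[m_1],\dots,\mathsf m_k:[m_k],\mathsf n_1:[0],\dots,\mathsf n_n:[0]\triangleright-\vdash t\{x_i:=\mathsf n_i[]\}_{i\le n}$, is independent, up to provable equality in $\mathcal E$, of the representative $t$, and it is a syntactic translation $\bar\tau_{\mathcal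 E}:\mathrm{IL}(M_{\mathcal E})\to\mathcal E$; 3. $\hat\tau_{\mathcal E}$ is an isomorphism $\mathcal E\cong\mathrm{IL}(M_{\mathcal E})$ in $\mathbf{SOEP}$, with inverse $\bar\tau_{\mathcal E}$. -/

import Mathlib

open CategoryTheory CategoryTheory.Limits

namespace SecondOrder

universe u v w

/-! ## Second-order signatures and terms -/

/-- `Idx Θ m` is the set of positions of the finite sequence `Θ ∈ ℕ*` at which the entry is `m`.
For a metavariable context `Θ = (𝗆₁ : [m₁], …, 𝗆ₖ : [mₖ])`, it is the set of the metavariables in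
`Θ` of meta-arity `m`.  A family `∀ m, Idx Θ m → X m` is thus exactly a tuple
`(x₁, …, xₖ)` with `xᵢ : X mᵢ`. -/
inductive Idx : List ℕ → ℕ → Type
  | zero {m : ℕ} {Θ : List ℕ} : Idx (m :: Θ) m
  | succ {m l : ℕ} {Θ : List ℕ} (i : Idx Θ m) : Idx (l :: Θ) m

namespace Idx

/-- Positions of `a` as positions of the concatenation `a ++ b`. -/
def inl : {a : List ℕ} → {m : ℕ} → (b : List ℕ) → Idx a m → Idx (a ++ b) m
  | _, _, _, .zero => .zero
  | _, _, b, .succ i => .succ (inl b i)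

/-- Positions of `b` as positions of the concatenation `a ++ b`. -/
def inr : (a : List ℕ) → {b : List ℕ} → {m : ℕ} → Idx b m → Idx (a ++ b) m
  | [], _, _, i => i
  | _ :: a, _, _, i => .succ (inr a i)

/-- Concatenation of tuples. -/
def elim {X : ℕ → Type u} : (a : List ℕ) → {b : List ℕ} → (∀ m, Idx a m → X m) →
    (∀ m, Idx b m → X m) → ∀ m, Idx (a ++ b) m → X m
  | [], _, _, r, m, i => r m i
  | _ :: _, _, l, _, _, .zero => l _ .zero
  | _ :: a, _, l, r, m, .succ i => elim a (fun m i => l m i.succ) r m i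

@[simp] theorem elim_inl {X : ℕ → Type u} {a b : List ℕ} (l : ∀ m, Idx a m → X m)
    (r : ∀ m, Idx b m → X m) {m : ℕ} (i : Idx a m) : elim a l r m (inl b i) = l m i := by
  induction i with
  | zero => rfl
  | succ i ih => exact ih _

@[simp] theorem elim_inr {X : ℕ → Type u} {a b : List ℕ} (l : ∀ m, Idx a m → X m)
    (r : ∀ m, Idx b m → X m) {m : ℕ} (i : Idx b m) : elim a l r m (inr a i) = r m i := by
  induction a with
  | nil => rfl
  | cons _ a ih => exact ih _

theorem append_cases {b : List ℕ} : ∀ {a : List ℕ} {P : ∀ m, Idx (a ++ b) m → Prop}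
    (_ : ∀ m (i : Idx a m), P m (inl b i)) (_ : ∀ m (i : Idx b m), P m (inr a i))
    (m : ℕ) (i : Idx (a ++ b) m), P m i
  | [], _, _, r, m, i => r m i
  | _ :: _, _, l, _, _, .zero => l _ .zero
  | _ :: _, P, l, r, m, .succ i =>
    append_cases (P := fun m i => P m i.succ) (fun m i => l m i.succ) (fun m i => r m i) m i

/-- The `j`-th position of the constant sequence `0ⁿ = (0, …, 0)`. -/
def ofFin : {n : ℕ} → Fin n → Idx (List.replicate n 0) 0
  | n + 1, j => Fin.cases (motive := fun _ => Idx (0 :: List.replicate n 0) 0)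
      .zero (fun j => .succ (ofFin j)) j

/-- The number of a position of the constant sequence `0ⁿ = (0, …, 0)`. -/
def toFin : {n : ℕ} → {m : ℕ} → Idx (List.replicate n 0) m → Fin n
  | _ + 1, _, .zero => 0
  | _ + 1, _, .succ i => (toFin i).succ

@[simp] theorem toFin_ofFin : ∀ {n : ℕ} (j : Fin n), toFin (ofFin j) = j
  | n + 1, j => by
    induction j using Fin.cases with
    | zero => rfl
    | succ j => exact congrArg Fin.succ (toFin_ofFin j)

/-- Positions of `(m₁, …, mₖ)` as positions of `(m₁ + 1, …, mₖ + 1)`. -/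
def up : {a : List ℕ} → {m : ℕ} → Idx a m → Idx (a.map (· + 1)) (m + 1)
  | _, _, .zero => .zero
  | _, _, .succ i => .succ (up i)

/-- A tuple indexed by `(m₁ + 1, …, mₖ + 1)`. -/
def upElim {X : ℕ → Type u} : (a : List ℕ) → (∀ m, Idx a m → X (m + 1)) →
    ∀ m, Idx (a.map (· + 1)) m → X m
  | _ :: _, f, _, .zero => f _ .zero
  | _ :: a, f, m, .succ i => upElim a (fun m i => f m i.succ) m i

@[simp] theorem upElim_up {X : ℕ → Type u} {a : List ℕ} (f : ∀ m, Idx a m → X (m + 1)) {m : ℕ}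
    (i : Idx a m) : upElim a f (m + 1) (up i) = f m i := by
  induction i with
  | zero => rfl
  | succ i ih => exact ih _

theorem up_cases : ∀ {a : List ℕ} {P : ∀ m, Idx (a.map (· + 1)) m → Prop}
    (_ : ∀ m (i : Idx a m), P (m + 1) (up i)) (m : ℕ) (i : Idx (a.map (· + 1)) m), P m i
  | _ :: _, _, h, _, .zero => h _ .zero
  | _ :: _, P, h, m, .succ i => up_cases (P := fun m i => P m i.succ) (fun m i => h m i.succ) m i

end Idx

/-- A (mono-sorted) second-order signature: a set of operators with arities in `ℕ*`.  An operator
of arity `(n₁, …, nₖ)` takes `k` arguments and binds `nᵢ` variables in the `i`-th argument. -/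
structure Signature where
  /-- the set of operators -/
  Op : Type u
  /-- the arity function -/
  arity : Op → List ℕ

/-- `Term S Θ n` is the set of second-order terms `Θ ▷ x₁, …, xₙ ⊢ t` over the signature `S`, up to
`α`-equivalence (in well-scoped nameless form).  In the context `Γ, y₁, …, yₘ` with
`Γ = x₁, …, xₙ`, the variables of `Γ` are `Fin.castAdd m i` and the new ones are `Fin.natAdd n j`. -/
inductive Term (S : Signature.{u}) (Θ : List ℕ) : ℕ → Type u
  | var {n : ℕ} (x : Fin n) : Term S Θ n
  | mv {n m : ℕ} (i : Idx Θ m) (ts : Fin m → Term S Θ n) : Term S Θ n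
  | op {n : ℕ} (o : S.Op) (ts : ∀ m, Idx (S.arity o) m → Term S Θ (n + m)) : Term S Θ n

/-- Extension of a renaming of variables by `m` fresh variables. -/
def liftR {n k : ℕ} (ρ : Fin n → Fin k) (m : ℕ) : Fin (n + m) → Fin (k + m) :=
  Fin.append (fun i => Fin.castAdd m (ρ i)) (fun j => Fin.natAdd k j)

namespace Term

variable {S : Signature.{u}} {Θ Ψ Ξ : List ℕ}

/-- Renaming of variables (in particular weakening of the variable context). -/
def ren : {n k : ℕ} → (Fin n → Fin k) → Term S Θ n → Term S Θ k
  | _, _, ρ, var x => var (ρ x)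
  | _, _, ρ, mv i ts => mv i (fun j => (ts j).ren ρ)
  | _, _, ρ, op o ts => op o (fun m i => (ts m i).ren (liftR ρ m))

/-- Extension of a substitution by `m` fresh variables, substituted by themselves. -/
def liftS {n k : ℕ} (σ : Fin n → Term S Θ k) (m : ℕ) : Fin (n + m) → Term S Θ (k + m) :=
  Fin.append (fun i => (σ i).ren (Fin.castAdd m)) (fun j => var (Fin.natAdd k j))

/-- Simultaneous capture-avoiding substitution `t {xᵢ := σ i}`. -/
def subst : {n k : ℕ} → (Fin n → Term S Θ k) → Term S Θ n → Term S Θ k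
  | _, _, σ, var x => σ x
  | _, _, σ, mv i ts => mv i (fun j => (ts j).subst σ)
  | _, _, σ, op o ts => op o (fun m i => (ts m i).subst (liftS σ m))

/-- Metasubstitution `t {𝗆ᵢ := (xᵢ) θᵢ}`, for `Θ ▷ Γ ⊢ t` and `Ψ ▷ Γ, xᵢ ⊢ θᵢ`. -/
def msubst : {n : ℕ} → (∀ m, Idx Θ m → Term S Ψ (n + m)) → Term S Θ n → Term S Ψ n
  | _, _, var x => var x
  | _, θ, mv i ts => (θ _ i).subst (Fin.append var (fun j => (ts j).msubst θ))
  | _, θ, op o ts =>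
    op o (fun m i => (ts m i).msubst (fun l j => (θ l j).ren (liftR (Fin.castAdd m) l)))

/-- Metasubstitution `t {𝗆ᵢ := (xᵢ) θᵢ}`, where the `θᵢ` have no variables besides the
bound ones: `Θ ▷ Γ ⊢ t` and `Ψ ▷ xᵢ ⊢ θᵢ`. -/
def cmsubst {n : ℕ} (θ : ∀ m, Idx Θ m → Term S Ψ m) (t : Term S Θ n) : Term S Ψ n :=
  t.msubst (fun m i => (θ m i).ren (Fin.natAdd n))

/-! ### The substitution calculus -/

end Term

theorem liftR_liftR {n k l : ℕ} (ρ : Fin n → Fin k) (ρ' : Fin k → Fin l) (m : ℕ) :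
    (fun i => liftR ρ' m (liftR ρ m i)) = liftR (fun i => ρ' (ρ i)) m := by
  funext i
  refine Fin.addCases (fun i => ?_) (fun i => ?_) i <;> simp [liftR]

@[simp] theorem liftR_castAdd {n k : ℕ} (ρ : Fin n → Fin k) (m : ℕ) (i : Fin n) :
    liftR ρ m (Fin.castAdd m i) = Fin.castAdd m (ρ i) := by simp [liftR]

@[simp] theorem liftR_natAdd {n k : ℕ} (ρ : Fin n → Fin k) (m : ℕ) (i : Fin m) :
    liftR ρ m (Fin.natAdd n i) = Fin.natAdd k i := by simp [liftR]

@[simp] theorem liftR_id {n : ℕ} (m : ℕ) : liftR (fun i : Fin n => i) m = fun i => i := by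
  funext i
  refine Fin.addCases (fun i => ?_) (fun i => ?_) i <;> simp [liftR]

namespace Term

variable {S : Signature.{u}} {Θ Ψ Ξ : List ℕ}

@[simp] theorem liftS_castAdd {n k : ℕ} (σ : Fin n → Term S Θ k) (m : ℕ) (i : Fin n) :
    liftS σ m (Fin.castAdd m i) = (σ i).ren (Fin.castAdd m) := by simp [liftS]

@[simp] theorem liftS_natAdd {n k : ℕ} (σ : Fin n → Term S Θ k) (m : ℕ) (i : Fin m) :
    liftS σ m (Fin.natAdd n i) = var (Fin.natAdd k i) := by simp [liftS]

theorem ren_id {n : ℕ} (t : Term S Θ n) : t.ren (fun i => i) = t := by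
  induction t with
  | var x => rfl
  | mv i ts ih => simp [ren, ih]
  | op o ts ih => simp [ren, ih]

theorem ren_ren {n k l : ℕ} (ρ : Fin n → Fin k) (ρ' : Fin k → Fin l) (t : Term S Θ n) :
    (t.ren ρ).ren ρ' = t.ren (fun i => ρ' (ρ i)) := by
  induction t generalizing k l with
  | var x => rfl
  | mv i ts ih => simp [ren, ih]
  | op o ts ih => simp [ren, ih, liftR_liftR]

theorem subst_ren {n k l : ℕ} (ρ : Fin n → Fin k) (σ : Fin k → Term S Θ l) (t : Term S Θ n) :
    (t.ren ρ).subst σ = t.subst (fun i => σ (ρ i)) := by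
  induction t generalizing k l with
  | var x => rfl
  | mv i ts ih => simp [ren, subst, ih]
  | op o ts ih =>
    simp only [ren, subst, ih]
    congr 1; funext m i; congr 1; funext j
    refine Fin.addCases (fun i => ?_) (fun i => ?_) j <;> simp

theorem ren_subst {n k l : ℕ} (σ : Fin n → Term S Θ k) (ρ : Fin k → Fin l) (t : Term S Θ n) :
    (t.subst σ).ren ρ = t.subst (fun i => (σ i).ren ρ) := by
  induction t generalizing k l with
  | var x => rfl
  | mv i ts ih => simp [ren, subst, ih]
  | op o ts ih =>
    simp only [ren, subst, ih]
    congr 1; funext m i; congr 1; funext j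
    refine Fin.addCases (fun i => ?_) (fun i => ?_) j <;> simp [ren_ren, ren]

theorem subst_subst {n k l : ℕ} (σ : Fin n → Term S Θ k) (σ' : Fin k → Term S Θ l)
    (t : Term S Θ n) : (t.subst σ).subst σ' = t.subst (fun i => (σ i).subst σ') := by
  induction t generalizing k l with
  | var x => rfl
  | mv i ts ih => simp [subst, ih]
  | op o ts ih =>
    simp only [subst, ih]
    congr 1; funext m i; congr 1; funext j
    refine Fin.addCases (fun i => ?_) (fun i => ?_) j <;> simp [subst_ren, ren_subst, subst]

@[simp] theorem liftS_var {n : ℕ} (m : ℕ) :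
    liftS (fun i : Fin n => (var i : Term S Θ n)) m = fun i => var i := by
  funext i
  refine Fin.addCases (fun i => ?_) (fun i => ?_) i <;> simp [ren]

@[simp] theorem subst_var {n : ℕ} (t : Term S Θ n) : t.subst (fun i => var i) = t := by
  induction t with
  | var x => rfl
  | mv i ts ih => simp [subst, ih]
  | op o ts ih => simp [subst, ih]

theorem ren_eq_subst {n k : ℕ} (ρ : Fin n → Fin k) (t : Term S Θ n) :
    t.ren ρ = t.subst (fun i => var (ρ i)) := by
  rw [← subst_ren ρ (fun i => var i), subst_var]

theorem ren_msubst {n k : ℕ} (θ : ∀ m, Idx Θ m → Term S Ψ (n + m)) (ρ : Fin n → Fin k)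
    (t : Term S Θ n) :
    (t.msubst θ).ren ρ = (t.ren ρ).msubst (fun m i => (θ m i).ren (liftR ρ m)) := by
  induction t generalizing k with
  | var x => rfl
  | mv i ts ih =>
    simp only [ren, msubst, ren_subst, subst_ren]
    congr 1; funext j
    refine Fin.addCases (fun i => ?_) (fun i => ?_) j <;> simp [ren, ih]
  | op o ts ih =>
    simp only [ren, msubst, ih, ren_ren, liftR_liftR, liftR_castAdd]

/-- Substitution commutes with metasubstitution. -/
theorem msubst_subst {n k : ℕ} (σ : Fin n → Term S Θ k)
    (θ : ∀ m, Idx Θ m → Term S Ψ (n + m)) (θ' : ∀ m, Idx Θ m → Term S Ψ (k + m))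
    (h : ∀ m i, (θ m i).subst (liftS (fun j => (σ j).msubst θ') m) = θ' m i) (t : Term S Θ n) :
    (t.subst σ).msubst θ' = (t.msubst θ).subst (fun j => (σ j).msubst θ') := by
  induction t generalizing k with
  | var x => rfl
  | mv i ts ih =>
    simp only [subst, msubst]
    rw [← h, subst_subst, subst_subst]
    congr 1; funext j
    refine Fin.addCases (fun i => ?_) (fun i => ?_) j
    · simp [subst_ren, subst]
    · simp [subst, ih i σ θ θ' h]
  | op o ts ih =>
    simp only [subst, msubst]
    have key : ∀ m, (fun j => (liftS σ m j).msubst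
        (fun l j => (θ' l j).ren (liftR (Fin.castAdd m) l))) =
        liftS (fun j => (σ j).msubst θ') m := by
      intro m
      funext j
      refine Fin.addCases (fun i => ?_) (fun i => ?_) j <;> simp [ren_msubst, msubst]
    congr 1; funext m i
    rw [ih m i (liftS σ m) (fun l j => (θ l j).ren (liftR (Fin.castAdd m) l))
      (fun l j => (θ' l j).ren (liftR (Fin.castAdd m) l)), key]
    intro l j
    rw [key, subst_ren, ← h, ren_subst]
    congr 1; funext q
    refine Fin.addCases (fun i => ?_) (fun i => ?_) q <;> simp [ren_ren, ren]

/-- Metasubstitution is associative. -/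
theorem msubst_msubst {n : ℕ} (θ : ∀ m, Idx Θ m → Term S Ψ (n + m))
    (θ' : ∀ m, Idx Ψ m → Term S Ξ (n + m)) (t : Term S Θ n) :
    (t.msubst θ).msubst θ' = t.msubst (fun m i =>
      (θ m i).msubst (fun l j => (θ' l j).ren (liftR (Fin.castAdd m) l))) := by
  induction t with
  | var x => rfl
  | mv i ts ih =>
    simp only [msubst]
    rw [msubst_subst _ (fun l j => (θ' l j).ren (liftR (Fin.castAdd _) l))]
    · congr 1; funext j
      refine Fin.addCases (fun i => ?_) (fun i => ?_) j <;> simp [msubst, ih]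
    · intro l j
      rw [subst_ren]
      conv_rhs => rw [← subst_var (θ' l j)]
      congr 1; funext q
      refine Fin.addCases (fun i => ?_) (fun i => ?_) q <;> simp [msubst, ren]
  | op o ts ih =>
    simp only [msubst, ih, ren_msubst, ren_ren, liftR_liftR, liftR_castAdd]

theorem msubst_id {n : ℕ} (t : Term S Θ n) :
    t.msubst (fun _ i => mv i (fun j => var (Fin.natAdd n j))) = t := by
  induction t with
  | var x => rfl
  | mv i ts ih => simp [msubst, subst, ih]
  | op o ts ih => simp [msubst, ren, ih]

theorem subst_msubst {p n k : ℕ} (ρ : Fin p → Fin n) (ρ' : Fin p → Fin k)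
    (σ : Fin n → Term S Ψ k) (h : ∀ j, σ (ρ j) = var (ρ' j))
    (θ : ∀ m, Idx Θ m → Term S Ψ (n + m)) (t : Term S Θ p) :
    ((t.ren ρ).msubst θ).subst σ =
      (t.ren ρ').msubst (fun m i => (θ m i).subst (liftS σ m)) := by
  induction t generalizing n k with
  | var x => simp [ren, msubst, subst, h]
  | mv i ts ih =>
    simp only [ren, msubst, subst_subst]
    congr 1; funext j
    refine Fin.addCases (fun i => ?_) (fun i => ?_) j
    · simp [subst, subst_ren]
    · simp [subst, ih i ρ ρ' σ h]
  | op o ts ih =>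
    simp only [ren, msubst, subst]
    congr 1; funext m i
    rw [ih m i (liftR ρ m) (liftR ρ' m) (liftS σ m)]
    · congr 1; funext l j
      rw [subst_ren, ren_subst]
      congr 1; funext q
      refine Fin.addCases (fun i => ?_) (fun i => ?_) q <;> simp [ren_ren, ren]
    · intro j
      refine Fin.addCases (fun i => ?_) (fun i => ?_) j <;> simp [h, ren]

@[simp] theorem cmsubst_mv {n m : ℕ} (θ : ∀ m, Idx Θ m → Term S Ψ m) (i : Idx Θ m)
    (ts : Fin m → Term S Θ n) :
    (mv i ts).cmsubst θ = (θ m i).subst (fun j => (ts j).cmsubst θ) := by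
  simp [cmsubst, msubst, subst_ren]

@[simp] theorem cmsubst_var {n : ℕ} (θ : ∀ m, Idx Θ m → Term S Ψ m) (x : Fin n) :
    (var x : Term S Θ n).cmsubst θ = var x := rfl

theorem cmsubst_cmsubst {n : ℕ} (θ : ∀ m, Idx Θ m → Term S Ψ m)
    (θ' : ∀ m, Idx Ψ m → Term S Ξ m) (t : Term S Θ n) :
    (t.cmsubst θ).cmsubst θ' = t.cmsubst (fun m i => (θ m i).cmsubst θ') := by
  simp only [cmsubst, msubst_msubst, ren_ren, ren_msubst]
  simp only [liftR_natAdd]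

theorem cmsubst_id {n : ℕ} (t : Term S Θ n) :
    t.cmsubst (fun _ i => mv i (fun j => var j)) = t := msubst_id t

end Term

/-! ## Equational presentations and Second-Order Equational Logic -/

/-- A second-order equational presentation: a signature and a set of equations
`Θ ▷ x₁, …, xₙ ⊢ s ≡ t`, the axioms. -/
structure Presentation where
  /-- the signature -/
  sig : Signature.{u}
  /-- the axioms -/
  Ax : ∀ {Θ : List ℕ} {n : ℕ}, Term sig Θ n → Term sig Θ n → Prop

/-- Second-Order Equational Logic.  In the rule of extended metasubstitution, `Γ` has
`n` variables and `Δ` has `k` variables. -/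
inductive Derivable (E : Presentation.{u}) :
    ∀ {Θ : List ℕ} {n : ℕ}, Term E.sig Θ n → Term E.sig Θ n → Prop
  | ax {Θ : List ℕ} {n : ℕ} {s t : Term E.sig Θ n} : E.Ax s t → Derivable E s t
  | refl {Θ : List ℕ} {n : ℕ} (t : Term E.sig Θ n) : Derivable E t t
  | symm {Θ : List ℕ} {n : ℕ} {s t : Term E.sig Θ n} : Derivable E s t → Derivable E t s
  | trans {Θ : List ℕ} {n : ℕ} {s t r : Term E.sig Θ n} :
      Derivable E s t → Derivable E t r → Derivable E s r
  | msubst {Θ Ψ : List ℕ} {n k : ℕ} {s t : Term E.sig Θ n}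
      {p q : ∀ m, Idx Θ m → Term E.sig Ψ (k + m)} :
      Derivable E s t → (∀ m i, Derivable E (p m i) (q m i)) →
      Derivable E
        ((s.ren (Fin.castAdd k)).msubst (fun m i => (p m i).ren (liftR (Fin.natAdd n) m)))
        ((t.ren (Fin.castAdd k)).msubst (fun m i => (q m i).ren (liftR (Fin.natAdd n) m)))

namespace Derivable

open Term

variable {E : Presentation.{u}} {Θ Ψ : List ℕ}

theorem cast {n k : ℕ} (h : n = k) {s t : Term E.sig Θ n} (d : Derivable E s t) :
    Derivable E (s.ren (Fin.cast h)) (t.ren (Fin.cast h)) := by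
  subst h
  exact (ren_id s).symm ▸ (ren_id t).symm ▸ d

/-- Extended metasubstitution with `Δ` empty. -/
theorem msubst_left {n : ℕ} {s t : Term E.sig Θ n} {p q : ∀ m, Idx Θ m → Term E.sig Ψ m}
    (d : Derivable E s t) (e : ∀ m i, Derivable E (p m i) (q m i)) :
    Derivable E (s.cmsubst p) (t.cmsubst q) := by
  have := Derivable.msubst (k := 0) (p := fun m i => (p m i).ren (Fin.cast (Nat.zero_add m).symm))
    (q := fun m i => (q m i).ren (Fin.cast (Nat.zero_add m).symm)) d (fun m i => (e m i).cast _)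
  have hρ : ∀ m, (fun i : Fin m => liftR (Fin.natAdd n) m (Fin.cast (Nat.zero_add m).symm i)) =
      (Fin.natAdd n : Fin m → Fin (n + m)) := by
    intro m
    funext i
    have : Fin.cast (Nat.zero_add m).symm i = Fin.natAdd 0 i := by ext; simp
    rw [this, liftR_natAdd]
    rfl
  have hc : ∀ r : Term E.sig Θ n, r.ren (Fin.castAdd 0) = r := fun r => ren_id r
  simp only [ren_ren, hρ] at this
  have hs : s.cmsubst p = (s.ren (Fin.castAdd 0)).msubst
      (fun m i => (p m i).ren (Fin.natAdd n)) := by rw [hc]; rfl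
  have ht : t.cmsubst q = (t.ren (Fin.castAdd 0)).msubst
      (fun m i => (q m i).ren (Fin.natAdd n)) := by rw [hc]; rfl
  rw [hs, ht]
  exact this

theorem subst_left {n k : ℕ} (σ : Fin n → Term E.sig Θ k) {s t : Term E.sig Θ n}
    (d : Derivable E s t) : Derivable E (s.subst σ) (t.subst σ) := by
  let T : Term E.sig (n :: Θ) k :=
    mv .zero (fun j => (σ j).cmsubst (fun _ i => mv (.succ i) (fun j => var j)))
  let P : Term E.sig Θ n → ∀ m, Idx (n :: Θ) m → Term E.sig Θ m := fun r m i =>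
    match i with
    | .zero => r
    | .succ i => mv i (fun j => var j)
  have key : ∀ r, T.cmsubst (P r) = r.subst σ := by
    intro r
    simp only [T, cmsubst_mv, cmsubst_cmsubst]
    simp [P, cmsubst_id]
  rw [← key s, ← key t]
  refine msubst_left (Derivable.refl T) (fun m i => ?_)
  match i with
  | .zero => exact d
  | .succ i => exact Derivable.refl _

theorem ren {n k : ℕ} (ρ : Fin n → Fin k) {s t : Term E.sig Θ n}
    (d : Derivable E s t) : Derivable E (s.ren ρ) (t.ren ρ) := by
  simpa only [ren_eq_subst] using d.subst_left (fun i => var (ρ i))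

/-- Extended metasubstitution with shared variable context. -/
theorem msubst_shared {n : ℕ} {s t : Term E.sig Θ n}
    {p q : ∀ m, Idx Θ m → Term E.sig Ψ (n + m)}
    (d : Derivable E s t) (e : ∀ m i, Derivable E (p m i) (q m i)) :
    Derivable E (s.msubst p) (t.msubst q) := by
  have := (Derivable.msubst d e).ren (Fin.append (fun i => i) (fun i => i))
  simp only [ren_msubst, ren_ren, liftR_liftR] at this
  simpa only [Fin.append_left, Fin.append_right, liftR_id, ren_id] using this

theorem mv {n m : ℕ} (i : Idx Θ m) {ts us : Fin m → Term E.sig Θ n}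
    (d : ∀ j, Derivable E (ts j) (us j)) : Derivable E (Term.mv i ts) (Term.mv i us) := by
  let T : Term E.sig (Θ ++ List.replicate m 0) n :=
    Term.mv (i.inl _) (fun j => Term.mv (Idx.inr Θ (Idx.ofFin j)) Fin.elim0)
  let P : (Fin m → Term E.sig Θ n) → ∀ l, Idx (Θ ++ List.replicate m 0) l →
      Term E.sig Θ (n + l) := fun r => Idx.elim (X := fun l => Term E.sig Θ (n + l)) Θ
    (fun l i => Term.mv i (fun j => var (Fin.natAdd n j)))
    (fun l i => (r i.toFin).ren (Fin.castAdd l))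
  have key : ∀ r, T.msubst (P r) = Term.mv i r := by
    intro r
    simp only [T, P, Term.msubst, Idx.elim_inl, Idx.elim_inr, Idx.toFin_ofFin, Term.subst,
      Fin.append_right, subst_ren]
    congr 1; funext j
    conv_rhs => rw [← subst_var (r j)]
    congr 1; funext x
    exact Fin.append_left (n := 0) _ _ _
  rw [← key ts, ← key us]
  refine msubst_shared (Derivable.refl T) (Idx.append_cases (fun l i => ?_) (fun l i => ?_))
  · simpa [P] using Derivable.refl _
  · simpa [P] using (d _).ren _

end Derivable

/-! ## The category `M` of elementary terms -/

/-- Tuples `⟨ a ▷ x₁, …, x_{bᵢ} ⊢ tᵢ ⟩ᵢ` of terms, for `a, b ∈ ℕ*`. -/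
abbrev Tuple (S : Signature.{u}) (a b : List ℕ) : Type u := ∀ m, Idx b m → Term S a m

namespace Tuple

variable {S : Signature.{u}}

/-- The identity tuple `⟨ 𝗆ᵢ[x₁, …, x_{mᵢ}] ⟩ᵢ`. -/
def id (a : List ℕ) : Tuple S a a := fun _ i => .mv i (fun j => .var j)

/-- Composition by metasubstitution. -/
def comp {a b c : List ℕ} (f : Tuple S a b) (g : Tuple S b c) : Tuple S a c :=
  fun m i => (g m i).cmsubst f

/-- The one-element tuple `⟨ t ⟩ : a → (n)`. -/
def single {a : List ℕ} {n : ℕ} (t : Term S a n) : Tuple S a [n]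
  | _, .zero => t

/-- The first projection `a × b → a`. -/
def fst (a b : List ℕ) : Tuple S (a ++ b) a := fun _ i => .mv (i.inl b) (fun j => .var j)

/-- The second projection `a × b → b`. -/
def snd (a b : List ℕ) : Tuple S (a ++ b) b := fun _ i => .mv (Idx.inr a i) (fun j => .var j)

/-- The evaluation map `((0) ⇒ a) × (0) → a`, where `(0) ⇒ (m₁, …, mₖ) = (m₁ + 1, …, mₖ + 1)`: the
tuple `⟨ 𝗆ᵢ[x₁, …, x_{mᵢ}, 𝗇[]] ⟩ᵢ`. -/
def ev (a : List ℕ) : Tuple S (a.map (· + 1) ++ [0]) a := fun m i =>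
  .mv (i.up.inl [0])
    (Fin.append (fun j : Fin m => .var j) (fun _ : Fin 1 => .mv (Idx.inr _ .zero) Fin.elim0))

theorem id_comp {a b : List ℕ} (f : Tuple S a b) : comp (id a) f = f := by
  funext m i
  exact Term.cmsubst_id _

theorem comp_id {a b : List ℕ} (f : Tuple S a b) : comp f (id b) = f := by
  funext m i
  simp [comp, id]

theorem assoc {a b c d : List ℕ} (f : Tuple S a b) (g : Tuple S b c) (h : Tuple S c d) :
    comp (comp f g) h = comp f (comp g h) := by
  funext m i
  exact (Term.cmsubst_cmsubst _ _ _).symm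

end Tuple

/-- The signature without operators; its terms are the elementary terms. -/
def emptySig : Signature.{0} := ⟨PEmpty, PEmpty.elim⟩

/-- The objects of the category `M`, the finite sequences of natural numbers. -/
structure MObj where
  /-- the sequence -/
  seq : List ℕ

/-- The category `M`, the second-order theory of equality: its morphisms are the tuples of
elementary terms. -/
instance : Category.{0} MObj where
  Hom a b := Tuple emptySig a.seq b.seq
  id a := Tuple.id (S := emptySig) a.seq
  comp f g := Tuple.comp f g
  id_comp := Tuple.id_comp
  comp_id := Tuple.comp_id
  assoc := Tuple.assoc

/-! ## Syntactic translations -/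

/-- A syntactic translation between signatures: an operator `ω : (m₁, …, mₖ)` is mapped to a term
`𝗆₁ : [m₁], …, 𝗆ₖ : [mₖ] ▷ – ⊢ τ_ω`. -/
def SigTrans (S : Signature.{u}) (S' : Signature.{v}) : Type max u v :=
  ∀ o : S.Op, Term S' (S.arity o) 0

namespace SigTrans

open Term

variable {S : Signature.{u}} {S' : Signature.{v}} {S'' : Signature.{w}} {Θ Ψ : List ℕ}

/-- The extension of a syntactic translation to terms. -/
def ext (τ : SigTrans S S') : {n : ℕ} → Term S Θ n → Term S' Θ n
  | _, .var x => .var x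
  | _, .mv i ts => .mv i (fun j => τ.ext (ts j))
  | _, .op o ts => ((τ o).ren Fin.elim0).msubst (fun m i => τ.ext (ts m i))

/-- The syntactic identity translation `ω ↦ ω((x₁)𝗆₁[x₁], …, (xₖ)𝗆ₖ[xₖ])`. -/
def id (S : Signature.{u}) : SigTrans S S := fun o =>
  .op o (fun _ i => .mv i (fun j => .var (Fin.natAdd 0 j)))

/-- The composite of syntactic translations. -/
def comp (τ : SigTrans S S') (τ' : SigTrans S' S'') : SigTrans S S'' := fun o => τ'.ext (τ o)

theorem ext_ren (τ : SigTrans S S') {n k : ℕ} (ρ : Fin n → Fin k) (t : Term S Θ n) :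
    τ.ext (t.ren ρ) = (τ.ext t).ren ρ := by
  induction t generalizing k with
  | var x => rfl
  | mv i ts ih => simp [ext, Term.ren, ih]
  | op o ts ih =>
    simp only [ext, Term.ren, ih, ren_msubst, ren_ren]
    congr 2; funext x; exact x.elim0

theorem ext_subst (τ : SigTrans S S') {n k : ℕ} (σ : Fin n → Term S Θ k) (t : Term S Θ n) :
    τ.ext (t.subst σ) = (τ.ext t).subst (fun i => τ.ext (σ i)) := by
  induction t generalizing k with
  | var x => rfl
  | mv i ts ih => simp [ext, Term.subst, ih]
  | op o ts ih =>
    simp only [ext, Term.subst, ih]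
    rw [subst_msubst _ Fin.elim0 _ (fun j => j.elim0)]
    congr 1; funext m i; congr 1; funext j
    refine Fin.addCases (fun i => ?_) (fun i => ?_) j <;> simp [ext_ren, ext]

theorem ext_msubst (τ : SigTrans S S') {n : ℕ} (θ : ∀ m, Idx Θ m → Term S Ψ (n + m))
    (t : Term S Θ n) :
    τ.ext (t.msubst θ) = (τ.ext t).msubst (fun m i => τ.ext (θ m i)) := by
  induction t with
  | var x => rfl
  | mv i ts ih =>
    simp only [ext, Term.msubst, ext_subst]
    congr 1; funext j
    refine Fin.addCases (fun i => ?_) (fun i => ?_) j <;> simp [ext, ih]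
  | op o ts ih =>
    simp only [ext, Term.msubst, ih, msubst_msubst, ext_ren]

theorem ext_cmsubst (τ : SigTrans S S') {n : ℕ} (θ : ∀ m, Idx Θ m → Term S Ψ m)
    (t : Term S Θ n) :
    τ.ext (t.cmsubst θ) = (τ.ext t).cmsubst (fun m i => τ.ext (θ m i)) := by
  simp only [Term.cmsubst, ext_msubst, ext_ren]

theorem ext_comp (τ : SigTrans S S') (τ' : SigTrans S' S'') {n : ℕ} (t : Term S Θ n) :
    (τ.comp τ').ext t = τ'.ext (τ.ext t) := by
  induction t with
  | var x => rfl
  | mv i ts ih => simp [ext, ih]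
  | op o ts ih => simp only [ext, ih, ext_msubst, ext_ren, comp]

theorem ext_id {n : ℕ} (t : Term S Θ n) : (id S).ext t = t := by
  induction t with
  | var x => rfl
  | mv i ts ih => simp [ext, ih]
  | op o ts ih =>
    simp only [ext, ih, id, Term.ren, Term.msubst, subst_ren]
    congr 1; funext m i
    conv_rhs => rw [← subst_var (ts m i)]
    congr 1; funext j
    refine Fin.addCases (fun i => ?_) (fun i => ?_) j
    · simp only [liftR_castAdd, Fin.append_left]
    · simp only [liftR_natAdd, Fin.append_right]

/-- The unique translation from the empty signature; its extension is the inclusion of the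
elementary terms into the terms over `S`. -/
def ofEmpty (S : Signature.{u}) : SigTrans emptySig S := fun o => o.elim

/-- A signature translation is a syntactic translation of equational presentations if it maps
axioms to theorems. -/
def IsEquational (E : Presentation.{u}) (E' : Presentation.{v}) (τ : SigTrans E.sig E'.sig) :
    Prop :=
  ∀ (Θ : List ℕ) (n : ℕ) (s t : Term E.sig Θ n), E.Ax s t → Derivable E' (τ.ext s) (τ.ext t)

/-- Translations of presentations preserve derivability. -/
theorem IsEquational.derivable {E : Presentation.{u}} {E' : Presentation.{v}}
    {τ : SigTrans E.sig E'.sig} (h : IsEquational E E' τ) {n : ℕ} {s t : Term E.sig Θ n}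
    (d : Derivable E s t) : Derivable E' (τ.ext s) (τ.ext t) := by
  induction d with
  | ax h' => exact h _ _ _ _ h'
  | refl t => exact .refl _
  | symm _ ih => exact .symm ih
  | trans _ _ ih ih' => exact .trans ih ih'
  | msubst _ _ ih ih' =>
    simp only [ext_msubst, ext_ren]
    exact .msubst ih ih'

theorem ext_congr {S : Signature.{u}} {E' : Presentation.{v}} {τ τ' : SigTrans S E'.sig}
    (h : ∀ o, Derivable E' (τ o) (τ' o)) {n : ℕ} (t : Term S Θ n) :
    Derivable E' (τ.ext t) (τ'.ext t) := by
  induction t with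
  | var x => exact .refl _
  | mv i ts ih => exact Derivable.mv i ih
  | op o ts ih => exact Derivable.msubst_shared ((h o).ren _) ih

end SigTrans

/-- Syntactic translations of equational presentations. -/
structure EqTrans (E : Presentation.{u}) (E' : Presentation.{u}) where
  /-- the underlying translation of signatures -/
  trans : SigTrans E.sig E'.sig
  /-- axioms are mapped to theorems -/
  isEquational : trans.IsEquational E E'

/-- Two syntactic translations are identified if they map every operator to provably equal
terms. -/
instance EqTrans.setoid (E E' : Presentation.{u}) : Setoid (EqTrans E E') where
  r τ τ' := ∀ o, Derivable E' (τ.trans o) (τ'.trans o)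
  iseqv := ⟨fun _ _ => .refl _, fun h o => (h o).symm, fun h h' o => (h o).trans (h' o)⟩

/-- The syntactic identity translation. -/
def EqTrans.id (E : Presentation.{u}) : EqTrans E E where
  trans := SigTrans.id E.sig
  isEquational _ _ s t h := by simpa only [SigTrans.ext_id] using .ax h

/-- The composite of syntactic translations. -/
def EqTrans.comp {E E' E'' : Presentation.{u}} (τ : EqTrans E E') (τ' : EqTrans E' E'') :
    EqTrans E E'' where
  trans := τ.trans.comp τ'.trans
  isEquational _ _ s t h := by
    simpa only [SigTrans.ext_comp] using τ'.isEquational.derivable (τ.isEquational _ _ s t h)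

/-- The category `SOEP` of second-order equational presentations and syntactic translations
(up to provable equality). -/
instance : Category.{u} Presentation.{u} where
  Hom E E' := Quotient (EqTrans.setoid E E')
  id E := Quotient.mk _ (EqTrans.id E)
  comp := Quotient.map₂ EqTrans.comp (fun _ τ₁ h σ _ h' o =>
    (σ.isEquational.derivable (h o)).trans (SigTrans.ext_congr h' (τ₁.trans o)))
  id_comp := by
    rintro E E' ⟨τ⟩
    refine Quotient.sound (fun o => ?_)
    have : τ.trans.ext (SigTrans.id E.sig o) = τ.trans o := by
      simp only [SigTrans.id, SigTrans.ext]
      have := Term.msubst_id (τ.trans o)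
      convert this using 2
      conv_rhs => rw [← Term.ren_id (τ.trans o)]
      congr 1; funext x; exact x.elim0
    exact this ▸ .refl _
  comp_id := by
    rintro E E' ⟨τ⟩
    exact Quotient.sound (fun o => (SigTrans.ext_id (τ.trans o)).symm ▸ .refl _)
  assoc := by
    rintro E₁ E₂ E₃ E₄ ⟨τ₁⟩ ⟨τ₂⟩ ⟨τ₃⟩
    exact Quotient.sound (fun o => by
      have := SigTrans.ext_comp τ₂.trans τ₃.trans (τ₁.trans o)
      exact (show (EqTrans.comp τ₁ (EqTrans.comp τ₂ τ₃)).trans o =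
        (EqTrans.comp (EqTrans.comp τ₁ τ₂) τ₃).trans o from this) ▸ .refl _)

/-- The morphism of `SOEP` given by a syntactic translation. -/
def EqTrans.toHom {E E' : Presentation.{u}} (τ : EqTrans E E') : E ⟶ E' := Quotient.mk _ τ

/-! ## Second-order algebraic theories -/

/-- The set `ℕ*` of objects of a second-order algebraic theory. -/
structure Obj where
  /-- the sequence -/
  seq : List ℕ

/-- A second-order algebraic theory `M : 𝐌 → ℳ`: a small category `ℳ` with set of objects `ℕ*` and
an identity-on-objects functor `M` that is strictly cartesian (the empty sequence is terminal in
`ℳ`, and the images under `M` of the projections of `a × b = a ++ b` in `𝐌` are the projections of a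
product in `ℳ`) and preserves the exponentiable object `(0)` (the image under `M` of
the evaluation map `((0) ⇒ a) × (0) → a` of `𝐌` makes `(0) ⇒ a` an exponential in `ℳ`). -/
structure AlgTheory where
  /-- the category `ℳ` -/
  [cat : Category.{u} Obj]
  /-- the action of the functor `M` on morphisms -/
  map : ∀ {a b : List ℕ}, (MObj.mk a ⟶ MObj.mk b) → (Obj.mk a ⟶ Obj.mk b)
  map_id : ∀ a : List ℕ, map (𝟙 (MObj.mk a)) = 𝟙 (Obj.mk a)
  map_comp : ∀ {a b c : List ℕ} (f : MObj.mk a ⟶ MObj.mk b) (g : MObj.mk b ⟶ MObj.mk c),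
    map (f ≫ g) = map f ≫ map g
  /-- the empty sequence is terminal -/
  isTerminal : IsTerminal (Obj.mk [])
  /-- concatenation is the product, with the projections of `𝐌` -/
  isProduct : ∀ a b : List ℕ, IsLimit
    (BinaryFan.mk (map (a := a ++ b) (b := a) (Tuple.fst a b))
      (map (a := a ++ b) (b := b) (Tuple.snd a b)))
  /-- every `f : c × (0) → a` is `ev ∘ (g × (0))` for a unique exponential mate `g` -/
  isExponential : ∀ (a c : List ℕ) (f : Obj.mk (c ++ [0]) ⟶ Obj.mk a),
    ∃! g : Obj.mk c ⟶ Obj.mk (a.map (· + 1)),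
      (isProduct (a.map (· + 1)) [0]).lift
        (BinaryFan.mk (map (a := c ++ [0]) (b := c) (Tuple.fst c [0]) ≫ g)
          (map (a := c ++ [0]) (b := [0]) (Tuple.snd c [0]))) ≫
        map (a := a.map (· + 1) ++ [0]) (b := a) (Tuple.ev a) = f

namespace AlgTheory

/-- The identity-on-objects functor `M : 𝐌 → ℳ`. -/
def functor (T : AlgTheory.{u}) : letI := T.cat; MObj ⥤ Obj :=
  letI := T.cat
  { obj := fun a => ⟨a.seq⟩
    map := T.map
    map_id := fun a => T.map_id a.seq
    map_comp := T.map_comp }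

/-- The morphisms of the category `ℳ` of a second-order algebraic theory. -/
def Hom (T : AlgTheory.{u}) (a b : List ℕ) : Type u := letI := T.cat; Obj.mk a ⟶ Obj.mk b

/-- Composition `g ∘ f` in `ℳ`, in diagrammatic order. -/
def comp (T : AlgTheory.{u}) {a b c : List ℕ} (f : T.Hom a b) (g : T.Hom b c) : T.Hom a c :=
  letI := T.cat; CategoryStruct.comp (X := Obj.mk a) (Y := Obj.mk b) (Z := Obj.mk c) f g

/-- The tupling `⟨f₁, …, fₗ⟩ : a → (n₁, …, nₗ)` of `fᵢ : a → (nᵢ)` in `ℳ`. -/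
def tuple (T : AlgTheory.{u}) {a : List ℕ} :
    (b : List ℕ) → (∀ m, Idx b m → T.Hom a [m]) → T.Hom a b
  | [], _ => letI := T.cat; T.isTerminal.from (Obj.mk a)
  | n :: b, f => letI := T.cat
    (T.isProduct [n] b).lift
      (BinaryFan.mk (P := Obj.mk a) (f n .zero) (T.tuple b (fun m i => f m i.succ)))

/-- The operators `ω_f : (m₁, …, mₖ, 0ⁿ)` of the internal language, for
`f : (m₁, …, mₖ) → (n)` in `ℳ`. -/
def internalSig (T : AlgTheory.{u}) : Signature.{u} where
  Op := Σ (a : List ℕ) (n : ℕ), T.Hom a [n]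
  arity f := f.1 ++ List.replicate f.2.1 0

/-- The term `t_f = ω_f((x₁)𝗆₁[x₁], …, (xₖ)𝗆ₖ[xₖ], x₁, …, xₙ)` for `f : (m₁, …, mₖ) → (n)`. -/
def term (T : AlgTheory.{u}) {a : List ℕ} {n : ℕ} (f : T.Hom a [n]) : Term T.internalSig a n :=
  .op (S := T.internalSig) ⟨a, n, f⟩
    (Idx.elim (X := fun m => Term T.internalSig a (n + m)) a
      (fun _ i => .mv i (fun j => .var (Fin.natAdd n j)))
      (fun m i => .var (Fin.castAdd m i.toFin)))

/-- The axioms of the internal language. -/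
inductive InternalAx (T : AlgTheory.{u}) :
    ∀ {Θ : List ℕ} {n : ℕ}, Term T.internalSig Θ n → Term T.internalSig Θ n → Prop
  /-- `s ≡ t_{M⟨s⟩}` for every elementary term `s` -/
  | e1 {a : List ℕ} {n : ℕ} (s : Term emptySig a n) :
      InternalAx T ((SigTrans.ofEmpty T.internalSig).ext s) (T.term (T.map (a := a) (b := [n]) (Tuple.single s)))
  /-- `t_h ≡ t_g {𝗆ᵢ := (xᵢ) t_{fᵢ}}` if `h = g ∘ ⟨f₁, …, fₗ⟩` -/
  | e2 {a b : List ℕ} {n : ℕ} (h : T.Hom a [n]) (g : T.Hom b [n])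
      (f : ∀ m, Idx b m → T.Hom a [m]) : h = T.comp (T.tuple b f) g →
      InternalAx T (T.term h) ((T.term g).cmsubst (fun m i => T.term (f m i)))

/-- The internal language `IL(M)` of a second-order algebraic theory. -/
def internalLanguage (T : AlgTheory.{u}) : Presentation.{u} where
  sig := T.internalSig
  Ax := T.InternalAx

end AlgTheory

/-! ## The classifying theory of a presentation -/

namespace Presentation

variable (E : Presentation.{u})

/-- Provable equality of terms. -/
def provEq (Θ : List ℕ) (n : ℕ) : Setoid (Term E.sig Θ n) where
  r s t := Derivable E s t
  iseqv := ⟨.refl, .symm, .trans⟩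

/-- Tuples `⟨ [a ▷ x₁, …, x_{bᵢ} ⊢ tᵢ] ⟩ᵢ` of equivalence classes of terms: the
morphisms `a → b` of the classifying category. -/
def ClassTuple (a b : List ℕ) : Type u := ∀ m, Idx b m → Quotient (E.provEq a m)

namespace ClassTuple

variable {E}

/-- The tuple of the classes of a tuple of terms. -/
def ofTuple {a b : List ℕ} (f : Tuple E.sig a b) : ClassTuple E a b :=
  fun m i => Quotient.mk (E.provEq a m) (f m i)

/-- A tuple of representatives. -/
noncomputable def out {a b : List ℕ} (f : ClassTuple E a b) : Tuple E.sig a b :=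
  fun m i => Quotient.out (f m i)

theorem ofTuple_out {a b : List ℕ} (f : ClassTuple E a b) : ofTuple f.out = f := by
  funext m i
  exact Quotient.out_eq _

theorem ofTuple_eq_iff {a b : List ℕ} {f g : Tuple E.sig a b} :
    ofTuple f = ofTuple g ↔ ∀ m i, Derivable E (f m i) (g m i) :=
  ⟨fun h m i => Quotient.exact (s := E.provEq a m) (congrFun (congrFun h m) i),
    fun h => by funext m i; exact Quotient.sound (s := E.provEq a m) (h m i)⟩

theorem ind {a b : List ℕ} {P : ClassTuple E a b → Prop} (h : ∀ f, P (ofTuple f)) (f) : P f :=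
  ofTuple_out f ▸ h _

/-- Composition, defined on representatives. -/
noncomputable def comp {a b c : List ℕ} (f : ClassTuple E a b) (g : ClassTuple E b c) :
    ClassTuple E a c := ofTuple (Tuple.comp f.out g.out)

theorem ofTuple_comp {a b c : List ℕ} (f : Tuple E.sig a b) (g : Tuple E.sig b c) :
    comp (ofTuple f) (ofTuple g) = ofTuple (Tuple.comp f g) :=
  ofTuple_eq_iff.2 (fun m i => .msubst_left (ofTuple_eq_iff.1 (ofTuple_out (ofTuple g)) m i)
    (ofTuple_eq_iff.1 (ofTuple_out (ofTuple f))))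

end ClassTuple

open ClassTuple

/-- The classifying category of a presentation. -/
@[reducible] noncomputable def classCat : Category.{u} Obj where
  Hom a b := ClassTuple E a.seq b.seq
  id a := ofTuple (Tuple.id (S := E.sig) a.seq)
  comp f g := comp f g
  id_comp f := by
    induction f using ind with | _ f => rw [ofTuple_comp, Tuple.id_comp]
  comp_id f := by
    induction f using ind with | _ f => rw [ofTuple_comp, Tuple.comp_id]
  assoc f g h := by
    induction f using ind with | _ f =>
    induction g using ind with | _ g =>
    induction h using ind with | _ h =>
    simp only [ofTuple_comp, Tuple.assoc]

variable {E}

/-- The inclusion of tuples of elementary terms into the classifying category. -/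
def ofElem {a b : List ℕ} (f : Tuple emptySig a b) : ClassTuple E a b :=
  ofTuple (fun m i => (SigTrans.ofEmpty E.sig).ext (f m i))

theorem ofElem_comp {a b c : List ℕ} (f : Tuple emptySig a b) (g : Tuple emptySig b c) :
    (ofElem (Tuple.comp f g) : ClassTuple E a c) = comp (ofElem f) (ofElem g) := by
  rw [ofElem, ofElem, ofElem, ofTuple_comp]
  simp only [Tuple.comp, SigTrans.ext_cmsubst]
  rfl

theorem ofElem_fst (a b : List ℕ) :
    (ofElem (Tuple.fst a b) : ClassTuple E (a ++ b) a) = ofTuple (Tuple.fst a b) := rfl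

theorem ofElem_snd (a b : List ℕ) :
    (ofElem (Tuple.snd a b) : ClassTuple E (a ++ b) b) = ofTuple (Tuple.snd a b) := rfl

theorem ofElem_ev (a : List ℕ) :
    (ofElem (Tuple.ev a) : ClassTuple E _ a) = ofTuple (Tuple.ev a) := by
  refine congrArg ofTuple ?_
  funext m i
  simp only [Tuple.ev, SigTrans.ext]
  congr 1; funext j
  refine Fin.addCases (fun i => ?_) (fun i => ?_) j
  · simp [SigTrans.ext]
  · simp only [Fin.append_right, SigTrans.ext]
    congr 1; funext x; exact x.elim0

/-- Pairing in the classifying category. -/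
def pair {a b c : List ℕ} (f : ClassTuple E c a) (g : ClassTuple E c b) :
    ClassTuple E c (a ++ b) := Idx.elim a f g

theorem ofTuple_pair {a b c : List ℕ} (f : Tuple E.sig c a) (g : Tuple E.sig c b) :
    pair (ofTuple f) (ofTuple g) = ofTuple (Idx.elim a f g) := by
  funext m i
  revert m i
  refine Idx.append_cases (fun m i => ?_) (fun m i => ?_)
  · simp only [ofTuple, Idx.elim_inl]
    exact Idx.elim_inl (X := fun m => Quotient (E.provEq c m)) _ _ i
  · simp only [ofTuple, Idx.elim_inr]
    exact Idx.elim_inr (X := fun m => Quotient (E.provEq c m)) _ _ i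

theorem pair_fst {a b c : List ℕ} (f : ClassTuple E c a) (g : ClassTuple E c b) :
    comp (pair f g) (ofTuple (Tuple.fst a b)) = f := by
  induction f using ind with | _ f =>
  induction g using ind with | _ g =>
  rw [ofTuple_pair, ofTuple_comp]
  refine congrArg ofTuple ?_
  funext m i
  simp [Tuple.comp, Tuple.fst]

theorem pair_snd {a b c : List ℕ} (f : ClassTuple E c a) (g : ClassTuple E c b) :
    comp (pair f g) (ofTuple (Tuple.snd a b)) = g := by
  induction f using ind with | _ f =>
  induction g using ind with | _ g =>
  rw [ofTuple_pair, ofTuple_comp]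
  refine congrArg ofTuple ?_
  funext m i
  simp [Tuple.comp, Tuple.snd]

theorem pair_eta {a b c : List ℕ} (h : ClassTuple E c (a ++ b)) :
    pair (comp h (ofTuple (Tuple.fst a b))) (comp h (ofTuple (Tuple.snd a b))) = h := by
  induction h using ind with | _ h =>
  rw [ofTuple_comp, ofTuple_comp, ofTuple_pair]
  refine congrArg ofTuple ?_
  funext m i
  revert m i
  refine Idx.append_cases (fun m i => ?_) (fun m i => ?_) <;>
    simp [Tuple.comp, Tuple.fst, Tuple.snd]

/-- The metasubstitution that replaces the last metavariable, of meta-arity `0`, by the last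
variable. -/
def mateSubst (S : Signature.{u}) (c : List ℕ) (m : ℕ) :
    ∀ l, Idx (c ++ [0]) l → Term S c (m + 1 + l) :=
  Idx.elim (X := fun l => Term S c (m + 1 + l)) c
    (fun _ i => .mv i (fun j => .var (Fin.natAdd _ j)))
    (fun l _ => .var (Fin.castAdd l (Fin.natAdd m 0)))

/-- Exponential mates: the last metavariable, of meta-arity `0`, is replaced by a new variable. -/
def mate {S : Signature.{u}} {c : List ℕ} {m : ℕ} (t : Term S (c ++ [0]) m) : Term S c (m + 1) :=
  (t.ren (Fin.castAdd 1)).msubst (mateSubst S c m)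

/-- The inverse of `mate`. -/
def unmate {S : Signature.{u}} {c : List ℕ} {m : ℕ} (t : Term S c (m + 1)) : Term S (c ++ [0]) m :=
  (t.cmsubst (Tuple.fst c [0])).subst
    (Fin.append (fun j : Fin m => .var j) (fun _ : Fin 1 => .mv (Idx.inr _ .zero) Fin.elim0))

theorem unmate_mate {S : Signature.{u}} {c : List ℕ} {m : ℕ} (t : Term S (c ++ [0]) m) :
    unmate (mate t) = t := by
  simp only [unmate, mate, Term.cmsubst, Term.msubst_msubst]
  rw [Term.subst_msubst _ (fun i => i)]
  · rw [Term.ren_id]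
    conv_rhs => rw [← Term.msubst_id t]
    congr 1; funext l i
    revert l i
    refine Idx.append_cases (fun l i => ?_) (fun l i => ?_)
    · simp [mateSubst, Term.msubst, Tuple.fst, Term.ren, Term.subst]
    · cases i with
      | zero =>
        simp only [mateSubst, Idx.elim_inr, Term.msubst, Term.subst, Term.liftS_castAdd,
          Fin.append_right, Term.ren]
        congr 1; funext x; exact x.elim0
      | succ i => cases i
  · intro j
    simp

theorem mate_unmate {S : Signature.{u}} {c : List ℕ} {m : ℕ} (t : Term S c (m + 1)) :
    mate (unmate t) = t := by
  simp only [unmate, mate, Term.ren_subst]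
  have key : (fun j : Fin (m + 1) => ((Fin.append (fun j : Fin m => (.var j : Term S (c ++ [0]) m))
      (fun _ : Fin 1 => .mv (Idx.inr _ .zero) Fin.elim0) j).ren (Fin.castAdd 1)).msubst
        (mateSubst S c m)) = fun j => .var j := by
    funext j
    refine Fin.addCases (fun i => ?_) (fun i => ?_) j
    · simp [Term.ren, Term.msubst]
    · obtain rfl : i = 0 := Subsingleton.elim _ _
      simp only [Fin.append_right, Term.ren, Term.msubst, mateSubst, Idx.elim_inr, Term.subst]
      exact Fin.append_left (n := 0) _ _ _
  rw [Term.msubst_subst _ (mateSubst S c m)]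
  · rw [key, Term.subst_var, Term.cmsubst, Term.msubst_msubst]
    conv_rhs => rw [← Term.msubst_id t]
    congr 1; funext l i
    simp [mateSubst, Term.msubst, Tuple.fst, Term.ren, Term.subst]
  · intro l i
    rw [key, Term.liftS_var, Term.subst_var]

theorem mate_congr {c : List ℕ} {m : ℕ} {s t : Term E.sig (c ++ [0]) m} (h : Derivable E s t) :
    Derivable E (mate s) (mate t) :=
  .msubst_shared (h.ren _) (fun _ _ => .refl _)

theorem pair_ev {a c : List ℕ} (g : Tuple E.sig c (a.map (· + 1))) :
    comp (pair (comp (ofTuple (Tuple.fst c [0])) (ofTuple g)) (ofTuple (Tuple.snd c [0]))) (ofTuple (Tuple.ev a)) =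
      ofTuple (fun m i => unmate (g (m + 1) i.up)) := by
  rw [ofTuple_comp, ofTuple_pair, ofTuple_comp]
  refine congrArg ofTuple ?_
  funext m i
  simp only [Tuple.comp, Tuple.ev, Term.cmsubst_mv, Idx.elim_inl, unmate]
  congr 1; funext j
  refine Fin.addCases (fun i => ?_) (fun i => ?_) j
  · simp
  · simp only [Fin.append_right, Term.cmsubst_mv, Idx.elim_inr, Tuple.snd, Term.subst]
    congr 1; funext x; exact x.elim0

theorem exists_unique_mate {a c : List ℕ} (f : ClassTuple E (c ++ [0]) a) :
    ∃! g : ClassTuple E c (a.map (· + 1)),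
      comp (pair (comp (ofTuple (Tuple.fst c [0])) g) (ofTuple (Tuple.snd c [0]))) (ofTuple (Tuple.ev a)) = f := by
  induction f using ind with | _ f =>
  refine ⟨ofTuple (Idx.upElim a (fun m i => mate (f m i))), ?_, ?_⟩
  · dsimp only
    rw [pair_ev]
    simp only [Idx.upElim_up, unmate_mate]
  · intro g
    induction g using ind with | _ g =>
    dsimp only
    rw [pair_ev, ofTuple_eq_iff, ofTuple_eq_iff]
    intro h
    refine Idx.up_cases (fun m i => ?_)
    rw [Idx.upElim_up]
    have := mate_congr (h m i)
    rwa [mate_unmate] at this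

variable (E)

/-- The classifying algebraic theory `M_E : 𝐌 → 𝐌(E)` of a presentation `E`. -/
noncomputable def classifyingTheory : AlgTheory.{u} :=
  letI : Category.{u} Obj := E.classCat
  { cat := E.classCat
    map := fun f => (ofElem f : ClassTuple E _ _)
    map_id := fun _ => rfl
    map_comp := fun f g => ofElem_comp f g
    isTerminal := IsTerminal.ofUniqueHom
      (fun a => (fun _ i => nomatch i : ClassTuple E a.seq []))
      (fun a f => (by funext _ i; exact nomatch i :
        (f : ClassTuple E a.seq []) = fun _ i => nomatch i))
    isProduct := fun a b => BinaryFan.IsLimit.mk _ (fun f g => pair f g)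
      (fun f g => pair_fst f g) (fun f g => pair_snd f g)
      (fun f g h hf hg => by
        subst hf; subst hg
        exact (pair_eta h).symm)
    isExponential := fun a c f => by
      have := exists_unique_mate (E := E) f
      rw [← ofElem_ev] at this
      exact this }

/-! ## The natural translations -/

/-- The class `⟨[t]_E⟩ : a → (n)` of a term `a ▷ x₁, …, xₙ ⊢ t`, as a morphism of the classifying
category. -/
def classOf {a : List ℕ} {n : ℕ} (t : Term E.sig a n) : E.classifyingTheory.Hom a [n] :=
  (ofTuple (Tuple.single t) : ClassTuple E a [n])

/-- The natural translation `E → IL(M_E)`: an operator `ω` is mapped to the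
term `t_f` for `f = ⟨[ω((x₁)𝗆₁[x₁], …, (xₖ)𝗆ₖ[xₖ])]_E⟩`. -/
noncomputable def naturalTrans : SigTrans E.sig E.classifyingTheory.internalLanguage.sig :=
  fun o => E.classifyingTheory.term (E.classOf (SigTrans.id E.sig o))

/-- The parameterisation of a term `Θ ▷ x₁, …, xₙ ⊢ t`: the
term `Θ, 𝗇₁ : [0], …, 𝗇ₙ : [0] ▷ – ⊢ t {xᵢ := 𝗇ᵢ[]}`. -/
def _root_.SecondOrder.Term.param {S : Signature.{u}} {Θ : List ℕ} {n : ℕ} (t : Term S Θ n) :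
    Term S (Θ ++ List.replicate n 0) 0 :=
  (t.cmsubst (Tuple.fst Θ (List.replicate n 0))).subst
    (fun j => .mv (Idx.inr Θ (Idx.ofFin j)) Fin.elim0)

/-- The opposite natural translation `IL(M_E) → E`: for `f = ⟨[t]_E⟩`, the operator `ω_f` is
mapped to the parameterisation of (a chosen representative) `t`. -/
noncomputable def oppositeTrans : SigTrans E.classifyingTheory.internalLanguage.sig E.sig :=
  fun f => Term.param (ClassTuple.out (E := E) (a := f.1) (b := [f.2.1]) f.2.2 f.2.1 .zero)

end Presentation

end SecondOrder

/-! Write `classTerm t` for the term `t_f` of the internal language with `f = ⟨[t]⟩`. The heart of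
the proof is that `t ↦ classTerm t` respects all formation of terms up to provable equality. The two
axiom schemes give this directly for elementary terms and for closed metasubstitution, where the
substituted terms have only their bound variables (`classTerm_ofEmpty`, `classTerm_cmsubst`).

Ordinary substitution is closed metasubstitution into an elementary term, which gives
`classTerm_subst`. Metasubstitution with shared variables is reduced to the closed case by
parameterisation: trading the variables for nullary metavariables is undone by a metasubstitution,
so it reflects provable equality (`of_param`), and it turns shared metasubstitution into a closed
one followed by a substitution (`param_msubst`). This gives `classTerm_msubst`, and by induction on
terms the natural translation sends `t` to `classTerm t` (`ext_naturalTrans`).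

Conversely, the opposite translation sends `classTerm t` back to `t`, because the arguments of `ω_f`
in `t_f` are exactly those that undo the parameterisation (`ext_oppositeTrans`). Soundness of both
translations follows from these two computations. One composite is the second computation on generic
operator applications. The other sends `ω_f` to `classTerm t.param`, hence to `(classTerm t).param`,
which is the generic application of `ω_f` itself (`param_classTerm`). -/

namespace SecondOrder

universe u v w

/-! ### Tuples indexed by constant sequences. -/

namespace Idx

/-- The `j`-th position of the constant sequence `kⁿ = (k, …, k)`. -/
def replicateOfFin (k : ℕ) : {n : ℕ} → Fin n → Idx (List.replicate n k) k
  | n + 1, j => Fin.cases (motive := fun _ => Idx (k :: List.replicate n k) k)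
      .zero (fun j => .succ (replicateOfFin k j)) j

/-- A tuple indexed by the constant sequence `kⁿ = (k, …, k)`. -/
def replicateElim {X : ℕ → Type u} {k : ℕ} : {n : ℕ} → (Fin n → X k) →
    ∀ m, Idx (List.replicate n k) m → X m
  | _ + 1, f, _, .zero => f 0
  | _ + 1, f, m, .succ i => replicateElim (fun j => f j.succ) m i

@[simp] theorem replicateElim_replicateOfFin {X : ℕ → Type u} {k : ℕ} :
    ∀ {n : ℕ} (f : Fin n → X k) (j : Fin n), replicateElim f k (replicateOfFin k j) = f j
  | n + 1, f, j => by
    induction j using Fin.cases with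
    | zero => rfl
    | succ j => exact replicateElim_replicateOfFin (fun j => f j.succ) j

/-- Used with `F = classTerm`, applied entrywise to the tuple that encodes a substitution. -/
theorem map_replicateElim {X Y : ℕ → Type u} {k : ℕ} (F : ∀ m, X m → Y m) :
    ∀ {n : ℕ} (f : Fin n → X k) (m : ℕ) (i : Idx (List.replicate n k) m),
      F m (replicateElim f m i) = replicateElim (fun j => F k (f j)) m i
  | _ + 1, _, _, .zero => rfl
  | _ + 1, f, m, .succ i => map_replicateElim F (fun j => f j.succ) m i

theorem ofFin_cases : ∀ {n : ℕ} {P : ∀ m, Idx (List.replicate n 0) m → Prop}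
    (_ : ∀ j : Fin n, P 0 (ofFin j)) (m : ℕ) (i : Idx (List.replicate n 0) m), P m i
  | _ + 1, _, h, _, .zero => h 0
  | _ + 1, P, h, m, .succ i =>
    ofFin_cases (P := fun m i => P m i.succ) (fun j => h j.succ) m i

end Idx

/-! ### Parameterisation and its interaction with metasubstitution. -/

namespace Term

variable {S : Signature.{u}} {Θ Ψ : List ℕ}

/-- Metasubstitutions that agree after a substitution yield terms that agree after it. -/
theorem msubst_subst_congr {n k : ℕ} (σ : Fin n → Term S Ψ k)
    (θ θ' : ∀ m, Idx Θ m → Term S Ψ (n + m))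
    (h : ∀ m i, (θ m i).subst (liftS σ m) = (θ' m i).subst (liftS σ m)) (t : Term S Θ n) :
    (t.msubst θ).subst σ = (t.msubst θ').subst σ := by
  induction t generalizing k with
  | var x => rfl
  | @mv n m i ts ih =>
    -- Separates the two places where `ϑ` enters: the head, which is covered by `h`, and the
    -- arguments, which are covered by the induction hypothesis.
    have key : ∀ ϑ : ∀ m, Idx Θ m → Term S Ψ (n + m), ((mv i ts).msubst ϑ).subst σ =
        ((ϑ m i).subst (liftS σ m)).subst
          (Fin.append var (fun j => ((ts j).msubst ϑ).subst σ)) := by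
      intro ϑ
      simp only [msubst, subst_subst]
      congr 1; funext j
      refine Fin.addCases (fun i => ?_) (fun i => ?_) j <;> simp [subst, subst_ren]
    rw [key, key, h]
    simp only [ih _ σ θ θ' h]
  | op o ts ih =>
    simp only [msubst, subst]
    congr 1; funext m i
    refine ih m i (liftS σ m) _ _ (fun l j => ?_)
    -- Under a binder the metasubstitution is weakened by `m` variables that `σ` leaves alone, so
    -- the weakening can be moved outside the substitution and `h` applies again.
    have key : (fun i => liftS (liftS σ m) l (liftR (Fin.castAdd m) l i)) =
        fun i => (liftS σ l i).ren (liftR (Fin.castAdd m) l) := by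
      funext q
      refine Fin.addCases (fun i => ?_) (fun i => ?_) q <;> simp [ren_ren, ren]
    rw [subst_ren, subst_ren, key, ← ren_subst, ← ren_subst, h]

/-- The metasubstitution that replaces the parameters `𝗇ⱼ : [0]` by the variables `xⱼ`. -/
def unparamSubst (S : Signature.{u}) (Θ : List ℕ) (n : ℕ) :
    ∀ m, Idx (Θ ++ List.replicate n 0) m → Term S Θ (n + m) :=
  Idx.elim (X := fun m => Term S Θ (n + m)) Θ
    (fun _ i => .mv i (fun j => .var (Fin.natAdd n j)))
    (fun m i => .var (Fin.castAdd m i.toFin))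

/-- The inverse of `Term.param`. -/
def unparam {n : ℕ} (t : Term S (Θ ++ List.replicate n 0) 0) : Term S Θ n :=
  (t.ren Fin.elim0).msubst (unparamSubst S Θ n)

/-- Each variable goes to its nullary metavariable and back, and the metavariables of `Θ` are
replaced by themselves. -/
theorem unparam_param {n : ℕ} (t : Term S Θ n) : unparam t.param = t := by
  simp only [unparam, param, ren_subst]
  have key : (fun j : Fin n => ((mv (Idx.inr Θ (Idx.ofFin j)) Fin.elim0 :
      Term S (Θ ++ List.replicate n 0) 0).ren Fin.elim0).msubst (unparamSubst S Θ n)) =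
        fun j => var j := by
    funext j
    simp only [ren, msubst, unparamSubst, Idx.elim_inr, Idx.toFin_ofFin, subst]
    exact Fin.append_left (n := 0) _ _ _
  rw [msubst_subst _ (unparamSubst S Θ n)]
  · rw [key, subst_var, cmsubst, msubst_msubst]
    conv_rhs => rw [← msubst_id t]
    congr 1; funext m i
    simp [unparamSubst, msubst, Tuple.fst, ren, subst]
  · intro m i
    rw [key, liftS_var, subst_var]

/-- The parameterisation of the first `n` variables of a term. -/
def paramFst {n m : ℕ} (t : Term S Θ (n + m)) : Term S (Θ ++ List.replicate n 0) m :=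
  (t.cmsubst (Tuple.fst Θ (List.replicate n 0))).subst
    (Fin.append (fun j => .mv (Idx.inr Θ (Idx.ofFin j)) Fin.elim0) .var)

/-- Once the shared variables are metavariables, the terms `θ m i` keep only their bound variables.
The right-hand side therefore uses only operations already controlled by the axioms of the internal
language. -/
theorem param_msubst {n : ℕ} (θ : ∀ m, Idx Θ m → Term S Ψ (n + m)) (t : Term S Θ n) :
    (t.msubst θ).param = (t.cmsubst (fun m i => (θ m i).paramFst)).subst
      (fun j => mv (Idx.inr Ψ (Idx.ofFin j)) Fin.elim0) := by
  simp only [param, cmsubst, msubst_msubst]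
  -- The two metasubstitutions differ, one still mentioning the shared variables, but they agree
  -- after those variables are replaced by parameters.
  refine msubst_subst_congr _ _ _ (fun m i => ?_) t
  simp only [paramFst, cmsubst, ren_subst, subst_subst, ren_ren, liftR_natAdd]
  congr 1; funext j
  refine Fin.addCases (fun i => ?_) (fun i => ?_) j
  · simp only [liftS_castAdd, Fin.append_left, ren, subst]
    congr 1; funext x; exact x.elim0
  · simp [ren, subst]

end Term

open Term

/-! ### Translations on elementary terms. -/

namespace SigTrans

/-- There is only one translation out of the empty signature. -/
theorem ext_ofEmpty {S : Signature.{u}} {S' : Signature.{v}} (τ : SigTrans S S') {Θ : List ℕ}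
    {n : ℕ} (s : Term emptySig Θ n) : τ.ext ((ofEmpty S).ext s) = (ofEmpty S').ext s := by
  rw [← ext_comp]
  congr 1; funext o; exact o.elim

end SigTrans

/-! ### Congruence rules for provable equality. -/

namespace Derivable

variable {E : Presentation.{u}} {Θ Ψ : List ℕ}

theorem subst {n k : ℕ} {s t : Term E.sig Θ n} {σ σ' : Fin n → Term E.sig Θ k}
    (d : Derivable E s t) (e : ∀ j, Derivable E (σ j) (σ' j)) :
    Derivable E (s.subst σ) (t.subst σ') := by
  refine (d.subst_left σ).trans ?_
  -- A fresh metavariable stands for `t`, so that `t.subst σ` is an instance of a metavariable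
  -- applied to the terms `σ j`; congruence for metavariable application then lets `σ` vary.
  let θ : Term E.sig Θ n → ∀ m, Idx (n :: Θ) m → Term E.sig Θ m := fun r m i =>
    match i with
    | .zero => r
    | .succ i => .mv i (fun j => .var j)
  have key : ∀ σ : Fin n → Term E.sig Θ k, (Term.mv .zero (fun j =>
      (σ j).cmsubst (fun _ i => .mv (.succ i) (fun j => .var j))) : Term E.sig (n :: Θ) k).cmsubst
        (θ t) = t.subst σ := by
    intro σ
    simp only [cmsubst_mv, cmsubst_cmsubst]
    simp [θ, cmsubst_id]
  rw [← key σ, ← key σ']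
  exact msubst_left (.mv _ (fun j => msubst_left (e j) (fun _ _ => .refl _))) (fun _ _ => .refl _)

theorem param {n : ℕ} {s t : Term E.sig Θ n} (d : Derivable E s t) :
    Derivable E s.param t.param :=
  (d.msubst_left (fun _ _ => .refl _)).subst_left _

/-- The left inverse `unparam` consists of a renaming and a metasubstitution, under both of which
provable equality is closed. -/
theorem of_param {n : ℕ} {s t : Term E.sig Θ n} (d : Derivable E s.param t.param) :
    Derivable E s t := by
  rw [← unparam_param s, ← unparam_param t]
  exact (d.ren _).msubst_shared (fun _ _ => .refl _)

end Derivable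

/-! ### Composition and tupling in the classifying theory, on representatives. -/

namespace Presentation

open ClassTuple

variable {E : Presentation.{u}} {a b Θ Ψ : List ℕ} {n k : ℕ}

theorem classOf_eq_iff {s t : Term E.sig a n} : E.classOf s = E.classOf t ↔ Derivable E s t := by
  refine (ofTuple_eq_iff (E := E) (f := Tuple.single s) (g := Tuple.single t)).trans
    ⟨fun h => h n .zero, fun h m i => ?_⟩
  match i with
  | .zero => exact h

theorem exists_classOf (f : E.classifyingTheory.Hom a [n]) : ∃ t, E.classOf t = f := by
  refine ⟨out (E := E) (a := a) (b := [n]) f n .zero, ?_⟩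
  refine Eq.trans ?_ (ofTuple_out (E := E) (a := a) (b := [n]) f)
  refine congrArg ofTuple ?_
  funext m i
  match i with
  | .zero => rfl

theorem map_single (s : Term emptySig a n) :
    E.classifyingTheory.map (a := a) (b := [n]) (Tuple.single s) =
      E.classOf ((SigTrans.ofEmpty E.sig).ext s) := by
  refine congrArg ofTuple ?_
  funext m i
  match i with
  | .zero => rfl

theorem tuple_classOf : ∀ (b : List ℕ) (f : Tuple E.sig a b),
    E.classifyingTheory.tuple b (fun m i => E.classOf (f m i)) = (ofTuple f : ClassTuple E a b)
  | [], f => by funext m i; exact nomatch i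
  | n :: b, f => by
    have ih := tuple_classOf b (fun m i => f m i.succ)
    -- The product lift of the classifying theory is `pair` by construction, so the recursion
    -- defining `tuple` unfolds definitionally.
    have : E.classifyingTheory.tuple (n :: b) (fun m i => E.classOf (f m i)) =
        pair (b := b) (E.classOf (f n .zero) : ClassTuple E a [n])
          (E.classifyingTheory.tuple b (fun m i => E.classOf (f m i.succ))) := rfl
    rw [this, ih]
    funext m i
    match i with
    | .zero => rfl
    | .succ i => rfl

theorem comp_tuple_classOf (f : Tuple E.sig a b) (t : Term E.sig b n) :
    E.classifyingTheory.comp (E.classifyingTheory.tuple b (fun m i => E.classOf (f m i)))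
      (E.classOf t) = E.classOf (t.cmsubst f) := by
  rw [tuple_classOf]
  refine (ofTuple_comp f (Tuple.single t)).trans (congrArg ofTuple ?_)
  funext m i
  match i with
  | .zero => rfl

/-! ### Compatibility of `classTerm` with the operations on terms. -/

/-- The term `t_f` of the internal language of the classifying theory, for `f = ⟨[t]_E⟩`. -/
noncomputable def classTerm (t : Term E.sig Θ n) : Term E.classifyingTheory.internalLanguage.sig Θ n :=
  E.classifyingTheory.term (E.classOf t)

/-- A syntactic equality: the operator `ω_f` depends only on the class. -/
theorem classTerm_congr {s t : Term E.sig Θ n} (h : Derivable E s t) :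
    classTerm s = classTerm t :=
  congrArg E.classifyingTheory.term (classOf_eq_iff.2 h)

/-- This is the composition axiom, since composition in the classifying category is metasubstitution
of representatives. -/
theorem classTerm_cmsubst (f : Tuple E.sig a b) (t : Term E.sig b n) :
    Derivable E.classifyingTheory.internalLanguage (classTerm (t.cmsubst f))
      ((classTerm t).cmsubst (fun m i => classTerm (f m i))) :=
  .ax (.e2 _ _ _ (comp_tuple_classOf f t).symm)

theorem classTerm_ofEmpty (s : Term emptySig a n) :
    Derivable E.classifyingTheory.internalLanguage
      (classTerm ((SigTrans.ofEmpty E.sig).ext s)) ((SigTrans.ofEmpty _).ext s) :=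
  .symm (by
    rw [classTerm, ← map_single]
    exact .ax (.e1 s))

theorem classTerm_var (x : Fin n) :
    Derivable E.classifyingTheory.internalLanguage (classTerm (.var x : Term E.sig Θ n)) (.var x) :=
  classTerm_ofEmpty (E := E) (.var x)

theorem classTerm_mv_var {m : ℕ} (i : Idx Θ m) (ρ : Fin m → Fin n) :
    Derivable E.classifyingTheory.internalLanguage
      (classTerm (.mv i (fun j => .var (ρ j)) : Term E.sig Θ n)) (.mv i (fun j => .var (ρ j))) :=
  classTerm_ofEmpty (E := E) (.mv i (fun j => .var (ρ j)))

theorem classTerm_subst (σ : Fin n → Term E.sig Θ k) (t : Term E.sig Θ n) :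
    Derivable E.classifyingTheory.internalLanguage (classTerm (t.subst σ))
      ((classTerm t).subst (fun j => classTerm (σ j))) := by
  -- The elementary term `𝗆[𝗇₁[x₁, …, xₖ], …, 𝗇ₙ[x₁, …, xₖ]]`: its instance at `𝗆 := t`, `𝗇ⱼ := σ j`
  -- is `t.subst σ`. It is defined over every signature because this identity is needed both in `E`
  -- and in the internal language.
  let e (S : Signature.{u}) : Term S (n :: List.replicate n k) k :=
    .mv .zero (fun j => .mv (.succ (Idx.replicateOfFin k j)) (fun x => .var x))
  let P {S : Signature.{u}} (r : Term S Θ n) (σ : Fin n → Term S Θ k) :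
      Tuple S Θ (n :: List.replicate n k) := fun m i =>
    match i with
    | .zero => r
    | .succ i => Idx.replicateElim σ m i
  have key {S : Signature.{u}} (r : Term S Θ n) (σ : Fin n → Term S Θ k) :
      (e S).cmsubst (P r σ) = r.subst σ := by
    simp [e, P]
  have he : Derivable E.classifyingTheory.internalLanguage (classTerm (e E.sig)) (e _) :=
    classTerm_ofEmpty (E := E) (.mv (Θ := n :: List.replicate n k) .zero
      (fun j => .mv (.succ (Idx.replicateOfFin k j)) (fun x => .var x)))
  have := (classTerm_cmsubst (P t σ) (e E.sig)).trans (he.msubst_left (fun _ _ => .refl _))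
  rw [key] at this
  have hP : (fun m i => classTerm (P t σ m i)) = P (classTerm t) (fun j => classTerm (σ j)) := by
    funext m i
    match i with
    | .zero => rfl
    | .succ i =>
      exact Idx.map_replicateElim (X := fun m => Term _ Θ m)
        (Y := fun m => Term _ Θ m) (fun m => classTerm (n := m)) σ m i
  rwa [hP, key] at this

theorem classTerm_cmsubst_fst (t : Term E.sig Θ n) :
    Derivable E.classifyingTheory.internalLanguage (classTerm (t.cmsubst (Tuple.fst Θ Ψ)))
      ((classTerm t).cmsubst (Tuple.fst Θ Ψ)) :=
  (classTerm_cmsubst _ t).trans (.msubst_left (.refl _) (fun _ _ => classTerm_mv_var _ _))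

theorem classTerm_mv_elim0 (i : Idx Θ 0) :
    Derivable E.classifyingTheory.internalLanguage
      (classTerm (.mv i Fin.elim0 : Term E.sig Θ n)) (.mv i Fin.elim0) := by
  have h (S : Signature.{u}) :
      (Term.mv i Fin.elim0 : Term S Θ n) = .mv i (fun j => .var (Fin.elim0 j)) := by
    congr 1; funext x; exact x.elim0
  rw [h, h]
  exact classTerm_mv_var i _

theorem classTerm_param (t : Term E.sig Θ n) :
    Derivable E.classifyingTheory.internalLanguage (classTerm t.param) (classTerm t).param :=
  (classTerm_subst _ _).trans
    ((classTerm_cmsubst_fst t).subst (fun _ => classTerm_mv_elim0 _))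

theorem classTerm_paramFst (t : Term E.sig Θ (n + k)) :
    Derivable E.classifyingTheory.internalLanguage (classTerm t.paramFst)
      (classTerm t).paramFst := by
  refine (classTerm_subst _ _).trans ((classTerm_cmsubst_fst t).subst (fun j => ?_))
  refine Fin.addCases (fun i => ?_) (fun i => ?_) j
  · simpa using classTerm_mv_elim0 _
  · simpa using classTerm_var i

/-- The axioms only speak of closed metasubstitution, so both sides are compared after
parameterisation, where the shared variables have become metavariables. -/
theorem classTerm_msubst (θ : ∀ m, Idx Θ m → Term E.sig Ψ (n + m)) (t : Term E.sig Θ n) :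
    Derivable E.classifyingTheory.internalLanguage (classTerm (t.msubst θ))
      ((classTerm t).msubst (fun m i => classTerm (θ m i))) := by
  refine .of_param (.trans (.symm (classTerm_param _)) ?_)
  rw [param_msubst, param_msubst]
  refine (classTerm_subst _ _).trans (.subst ?_ (fun _ => classTerm_mv_elim0 _))
  exact (classTerm_cmsubst _ t).trans (.msubst_left (.refl _) (fun _ _ => classTerm_paramFst _))

/-! ### Values of the two translations on terms. -/

theorem op_eq_msubst {S : Signature.{u}} (o : S.Op)
    (ts : ∀ m, Idx (S.arity o) m → Term S Θ (n + m)) :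
    ((SigTrans.id S o).ren Fin.elim0).msubst ts = .op o ts := by
  have := SigTrans.ext_id (.op o ts)
  simpa only [SigTrans.ext, SigTrans.ext_id] using this

/-- The natural translation maps a term `t` to `t_f` for `f = ⟨[t]_E⟩`, up to provable equality. -/
theorem ext_naturalTrans (t : Term E.sig Θ n) :
    Derivable E.classifyingTheory.internalLanguage (E.naturalTrans.ext t) (classTerm t) := by
  induction t with
  | var x => exact .symm (classTerm_var x)
  | @mv n m i ts ih =>
    -- The application is a substitution instance of the generic one, which is elementary.
    have h : (Term.mv i (fun j => .var j) : Term E.sig Θ m).subst ts = .mv i ts := rfl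
    rw [← h]
    refine .trans (.mv i ih) (.symm ((classTerm_subst _ _).trans ?_))
    exact (classTerm_mv_var i (fun j => j)).subst_left _
  | op o ts ih =>
    -- The term is a metasubstitution instance of the generic application of `o`, whose `classTerm`
    -- is by definition the image of `o`. What remains is that `classTerm` respects weakening from
    -- the empty context, a substitution by variables.
    rw [← op_eq_msubst o ts]
    refine .trans ?_ (.symm (classTerm_msubst _ _))
    rw [op_eq_msubst]
    refine .msubst_shared ?_ ih
    rw [ren_eq_subst, ren_eq_subst]
    exact .symm ((classTerm_subst _ _).trans (.subst (.refl _) (fun _ => classTerm_var _)))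

/-- The chosen representative lies in the class of `t`, and parameterisation preserves provable
equality. -/
theorem oppositeTrans_classOf (t : Term E.sig a n) :
    Derivable E (E.oppositeTrans ⟨a, n, E.classOf t⟩) t.param :=
  (classOf_eq_iff.1 (by
    refine Eq.trans ?_ (ofTuple_out (E := E) (a := a) (b := [n]) (E.classOf t))
    refine congrArg ofTuple ?_
    funext m i
    match i with
    | .zero => rfl)).param

/-- The opposite natural translation maps `t_f`, for `f = ⟨[t]_E⟩`, to `t`, up to provable
equality. -/
theorem ext_oppositeTrans (t : Term E.sig Θ n) :
    Derivable E (E.oppositeTrans.ext (classTerm t)) t := by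
  -- The left side is the image of `ω_f` metasubstituted by the translated arguments of `t_f`; these
  -- are precisely `unparamSubst`, and the image of `ω_f` is `t.param` up to provable equality.
  conv => arg 3; rw [← unparam_param t]
  refine .msubst_shared ((oppositeTrans_classOf t).ren _) ?_
  refine Idx.append_cases (fun m i => ?_) (fun m i => ?_)
  · simpa [unparamSubst, SigTrans.ext] using .refl _
  · simpa [unparamSubst, SigTrans.ext] using .refl _

/-! ### Both translations map axioms to theorems. -/

theorem isEquational_naturalTrans :
    E.naturalTrans.IsEquational E E.classifyingTheory.internalLanguage := by
  intro Θ n s t h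
  refine (ext_naturalTrans s).trans ?_
  rw [classTerm_congr (.ax h)]
  exact .symm (ext_naturalTrans t)

theorem isEquational_oppositeTrans :
    E.oppositeTrans.IsEquational E.classifyingTheory.internalLanguage E := by
  intro Θ n s t h
  cases h with
  | e1 s =>
    rw [map_single]
    -- An elementary term has no operators, so the translation leaves it as it is.
    have h := SigTrans.ext_ofEmpty E.oppositeTrans s
    refine .trans ?_ (.symm (ext_oppositeTrans ((SigTrans.ofEmpty E.sig).ext s)))
    exact h ▸ .refl _
  | @e2 _ b _ g f e =>
    -- With representatives for `g` and the `fᵢ`, the composite `h` is the class of a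
    -- metasubstitution, and both sides of the axiom translate to that metasubstitution.
    obtain ⟨g, rfl⟩ := exists_classOf g
    choose f' hf using fun m i => exists_classOf (f m i)
    obtain rfl : (fun m i => E.classOf (f' m i)) = f := by funext m i; exact hf m i
    rw [comp_tuple_classOf] at e
    subst e
    refine (ext_oppositeTrans _).trans ?_
    have h := SigTrans.ext_cmsubst E.oppositeTrans (fun m i => classTerm (f' m i)) (classTerm g)
    refine .trans (.symm (.msubst_left (ext_oppositeTrans g) (fun _ _ => ext_oppositeTrans _))) ?_
    exact h ▸ .refl _

/-! ### The translations are mutually inverse. -/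

/-- The generic application of an operator `ω_f` is the parameterisation of `t_f`. -/
theorem param_classTerm (t : Term E.sig a n) :
    (classTerm t).param =
      SigTrans.id E.classifyingTheory.internalLanguage.sig ⟨a, n, E.classOf t⟩ := by
  simp only [classTerm, AlgTheory.term, Term.param, cmsubst, msubst, Term.subst, SigTrans.id]
  congr 1; funext m i
  revert m i
  -- The metavariable arguments of `t_f` are unchanged, while its variable arguments `xⱼ` become the
  -- nullary metavariables `𝗇ⱼ[]`.
  refine Idx.append_cases (fun m i => ?_) (Idx.ofFin_cases fun j => ?_)
  · simp only [Idx.elim_inl, msubst, Tuple.fst, Term.ren, Term.subst]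
    congr 1; funext j
    rw [liftR_natAdd, Fin.append_right, Term.subst, liftS_natAdd]
    rfl
  · simp only [Idx.elim_inr, Idx.toFin_ofFin, msubst, liftS_castAdd, Term.ren, Term.subst]
    congr 1; funext x; exact x.elim0

theorem oppositeTrans_comp_naturalTrans (o : E.classifyingTheory.internalLanguage.sig.Op) :
    Derivable E.classifyingTheory.internalLanguage (E.naturalTrans.ext (E.oppositeTrans o))
      (SigTrans.id _ o) := by
  obtain ⟨a, n, f⟩ := o
  obtain ⟨t, rfl⟩ := exists_classOf f
  -- Soundness of the natural translation allows the chosen representative to be exchanged for `t`.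
  refine (isEquational_naturalTrans.derivable (oppositeTrans_classOf t)).trans ?_
  rw [← param_classTerm]
  exact (ext_naturalTrans _).trans (classTerm_param t)

end Presentation

end SecondOrder

theorem theorem6p5 (E : SecondOrder.Presentation) :
    (∀ (a : List ℕ) (n : ℕ) (t : SecondOrder.Term E.sig a n),
      SecondOrder.Derivable E (E.oppositeTrans ⟨a, n, E.classOf t⟩) t.param) ∧
    ∃ (hτ : E.naturalTrans.IsEquational E E.classifyingTheory.internalLanguage)
      (hσ : E.oppositeTrans.IsEquational E.classifyingTheory.internalLanguage E)
      (e : E ≅ E.classifyingTheory.internalLanguage),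
      e.hom = SecondOrder.EqTrans.toHom ⟨E.naturalTrans, hτ⟩ ∧
      e.inv = SecondOrder.EqTrans.toHom ⟨E.oppositeTrans, hσ⟩ := by
  refine ⟨fun _ _ => SecondOrder.Presentation.oppositeTrans_classOf,
    SecondOrder.Presentation.isEquational_naturalTrans,
    SecondOrder.Presentation.isEquational_oppositeTrans, ⟨_, _, ?_, ?_⟩, rfl, rfl⟩
  -- The natural translation of `o` is by definition `classTerm` of its generic application.
  · exact Quotient.sound (fun o => SecondOrder.Presentation.ext_oppositeTrans _)
  · exact Quotient.sound (fun o => SecondOrder.Presentation.oppositeTrans_comp_naturalTrans o)
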